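/- Conventions. A poset is $\mu$-directed ($\mu$ a regular cardinal) if each of its subsets of cardinality $<\mu$ has an upper bound; directed means $\aleph_0$-directed; a $\mu$-directed colimit is the colimit of a diagram indexed by a (small) $\mu$-directed poset. An object $M$ of a category $\mathcal K$ is $\mu$-presentable if $\mathrm{Hom}_{\mathcal K}(M,-)$ preserves $\mu$-directed colimits; for an infinite cardinal $\lambda$, $M$ is $(<\lambda)$-presentable if it is $\theta$-presentable for some regular $\theta<\lambda+\aleph_1$. The presentability rank of $M$ is the least regular cardinal $\mu$ such that $M$ is $\mu$-presentable (if there is one). A (locally small) category $\mathcal K$ is $\mu$-accessible if it has $\mu$-directed colimits, has only a set of $\mu$-presentable objects up to isomorphism, and each of its objects is a $\mu$-directed colimit of $\mu$-presentable objects; finitely accessible means $\aleph_0$-accessible. An object $M$ is filtrable if it has a presentability rank $\kappa$ and there are a regular cardinal $\mu<\kappa$ and a diagram $\langle M_i : i<\mu\rangle$ in $\mathcal K$ indexed by the ordinal $\mu$, with all $M_i$ $(<\kappa)$-presentable, whose colimit is $M$. For a regular cardinal $\kappa$, $\mathcal K$ is $\kappa$-filtrable if every object of presentability rank $\kappa$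 is filtrable, and almost $\kappa$-filtrable if for every object $M$ of presentability rank $\kappa$ there is a split epimorphism $N\to M$ from a filtrable $\kappa$-presentable object $N$. For a regular cardinal $\mu$, $\mathcal K$ is (almost) well $\mu$-filtrable if it is (almost) $\kappa$-filtrable for every regular cardinal $\kappa\ge\mu$. Statement. Let $\lambda$ be a regular cardinal. (1) Every finitely accessible category is well $\aleph_1$-filtrable. (2) Every $\lambda$-accessible category with directed colimits is almost well $\lambda^+$-filtrable. (3) Every $\lambda$-accessible category with directed colimits in which all morphisms are monomorphisms is well $\lambda^+$-filtrable. -/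

import Mathlib

open CategoryTheory CategoryTheory.Limits Cardinal

universe w v u

namespace Filtrations

variable {C : Type u} [Category.{v} C]

/-- `X` is `κ`-presentable; this includes that the cardinal `κ` is regular. -/
def IsPresentableAt (X : C) (κ : Cardinal.{w}) : Prop :=
  ∃ _ : Fact κ.IsRegular, IsCardinalPresentable X κ

/-- `X` is `(<κ)`-presentable: it is `θ`-presentable for some regular `θ < κ + ℵ₁`. -/
def IsLTPresentable (X : C) (κ : Cardinal.{w}) : Prop :=
  ∃ θ : Cardinal.{w}, θ < κ + ℵ₁ ∧ IsPresentableAt X θ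

/-- `κ` is the presentability rank of `X`: the least regular cardinal `κ` such that
`X` is `κ`-presentable. -/
def HasPresentabilityRank (X : C) (κ : Cardinal.{w}) : Prop :=
  IsLeast {θ : Cardinal.{w} | IsPresentableAt X θ} κ

/-- A `(μ, <κ)`-chain: a diagram indexed by the cardinal `μ` (seen as an ordinal), all of whose
objects are `(<κ)`-presentable. -/
def IsLTChain (μ κ : Cardinal.{w}) (F : μ.ord.ToType ⥤ C) : Prop :=
  ∀ i : μ.ord.ToType, IsLTPresentable (F.obj i) κ

/-- `X` has a presentability rank `κ` and is the colimit of a `(μ, <κ)`-chain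
for some regular cardinal `μ < κ`. -/
def IsFiltrable (X : C) : Prop :=
  ∃ κ : Cardinal.{w}, HasPresentabilityRank X κ ∧
    ∃ μ : Cardinal.{w}, μ.IsRegular ∧ μ < κ ∧
      ∃ P : ColimitPresentation μ.ord.ToType X, IsLTChain μ κ P.diag

variable (C)

/-- Every object of presentability rank `κ` is filtrable. -/
def IsFiltrableCategory (κ : Cardinal.{w}) : Prop :=
  ∀ X : C, HasPresentabilityRank X κ → IsFiltrable.{w} X

/-- Every object of presentability rank `κ` is a retract of a filtrable `κ`-presentable object. -/
def IsAlmostFiltrableCategory (κ : Cardinal.{w}) : Prop :=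
  ∀ X : C, HasPresentabilityRank X κ →
    ∃ N : C, IsFiltrable.{w} N ∧ IsPresentableAt N κ ∧ ∃ p : N ⟶ X, IsSplitEpi p

def IsWellFiltrableCategory (μ : Cardinal.{w}) : Prop :=
  ∀ κ : Cardinal.{w}, κ.IsRegular → μ ≤ κ → IsFiltrableCategory C κ

def IsAlmostWellFiltrableCategory (μ : Cardinal.{w}) : Prop :=
  ∀ κ : Cardinal.{w}, κ.IsRegular → μ ≤ κ → IsAlmostFiltrableCategory C κ

/-- `C` has colimits of all diagrams indexed by (nonempty, small) directed posets. -/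
def HasDirectedColimits : Prop :=
  ∀ (J : Type w) [PartialOrder J] [IsDirectedOrder J] [Nonempty J], HasColimitsOfShape J C

end Filtrations

/-!
Let `X` be `κ`-presentable with `κ > λ`, and write it as the colimit of `λ`-presentable objects
`D j` over a directed poset `J`. The nonempty directed subsets `S` of `J` of size `< κ` form a
`κ`-directed poset, and `X` is the colimit of the `κ`-presentable objects `X_S = colim_{j ∈ S} D j`.
Hence `𝟙 X` factors through some `s : X ⟶ X_S`, and by presentability of the `X_S` the composites
`X_S ⟶ X ⟶ X_S` become the transition maps after enlarging `S`. Iterating this gives a countable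
chain of sets `S` along which the colimit is `X`. Since `κ > ℵ₀`, the union `T` of the chain still
has size `< κ`, so `X` is the colimit of `D` over `T`.

If `κ` is the presentability rank of `X`, then `|T| ≥ λ`, since otherwise `X` would be
`λ`-presentable. So `T` is infinite, hence the increasing union, along the cofinality of `|T|`, of
directed subsets of smaller size, and their colimits form the required chain.
-/

namespace Filtrations

lemma hasCardinalLT_finset {X : Type w} {κ : Cardinal.{w}} (hκ : ℵ₀ ≤ κ)
    (hX : HasCardinalLT X κ) : HasCardinalLT (Finset X) κ := by
  obtain _ | _ := finite_or_infinite X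
  · exact hasCardinalLT_of_finite _ _ hκ
  · rwa [hasCardinalLT_iff_cardinal_mk_lt, mk_finset_of_infinite,
      ← hasCardinalLT_iff_cardinal_mk_lt]

section DirectedHull

variable {I : Type w} [Preorder I] [IsDirectedOrder I] [Nonempty I]

open Classical in
/-- An upper bound of a finite subset of a directed preorder, chosen recursively over its strict
subsets so that it depends monotonically on the subset. -/
noncomputable def finsetBound (s : Finset I) : I :=
  (Finite.exists_le (Sum.elim (fun i : s ↦ i.1) fun t : s.ssubsets ↦ finsetBound t.1)).choose
termination_by s.card
decreasing_by all_goals exact Finset.card_lt_card (Finset.mem_ssubsets.1 t.2)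

open Classical in
lemma sumElim_le_finsetBound (s : Finset I) :
    ∀ x, Sum.elim (fun i : s ↦ i.1) (fun t : s.ssubsets ↦ finsetBound t.1) x ≤ finsetBound s := by
  rw [finsetBound]
  exact (Finite.exists_le _).choose_spec

lemma le_finsetBound {s : Finset I} {i : I} (hi : i ∈ s) : i ≤ finsetBound s :=
  sumElim_le_finsetBound s (Sum.inl ⟨i, hi⟩)

lemma finsetBound_mono : Monotone (finsetBound : Finset I → I) := by
  classical
  intro t s hts
  obtain rfl | hts := hts.eq_or_ssubset
  · exact le_rfl
  · exact sumElim_le_finsetBound s (Sum.inr ⟨t, Finset.mem_ssubsets.2 hts⟩)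

/-- A directed set containing `S`: the elements of `S` together with the chosen upper bounds of its
finite subsets. -/
def directedHull (S : Set I) : Set I := S ∪ finsetBound '' {s | ↑s ⊆ S}

lemma subset_directedHull (S : Set I) : S ⊆ directedHull S := Set.subset_union_left

lemma directedHull_mono : Monotone (directedHull : Set I → Set I) := fun _ _ hST ↦
  Set.union_subset_union hST (Set.image_mono fun _ hs ↦ hs.trans hST)

lemma directedHull_nonempty (S : Set I) : (directedHull S).Nonempty :=
  ⟨finsetBound ∅, .inr ⟨∅, by simp, rfl⟩⟩

lemma directedOn_directedHull (S : Set I) : DirectedOn (· ≤ ·) (directedHull S) := by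
  classical
  have exists_finset_le : ∀ x ∈ directedHull S, ∃ s : Finset I, ↑s ⊆ S ∧ x ≤ finsetBound s := by
    rintro x (hx | ⟨s, hs, rfl⟩)
    · exact ⟨{x}, by simpa using hx, le_finsetBound (Finset.mem_singleton_self x)⟩
    · exact ⟨s, hs, le_rfl⟩
  intro x hx y hy
  obtain ⟨s, hs, hxs⟩ := exists_finset_le x hx
  obtain ⟨t, ht, hyt⟩ := exists_finset_le y hy
  exact ⟨finsetBound (s ∪ t), .inr ⟨s ∪ t, by simp [hs, ht], rfl⟩,
    hxs.trans (finsetBound_mono Finset.subset_union_left),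
    hyt.trans (finsetBound_mono Finset.subset_union_right)⟩

lemma hasCardinalLT_directedHull {S : Set I} {κ : Cardinal.{w}} (hκ : ℵ₀ ≤ κ)
    (hS : HasCardinalLT S κ) : HasCardinalLT (directedHull S) κ := by
  classical
  refine hasCardinalLT_union hκ hS ((hasCardinalLT_finset hκ hS).of_surjective
    (fun s ↦ ⟨finsetBound (s.map (.subtype _)), _, by simp, rfl⟩) ?_)
  rintro ⟨_, s, hs, rfl⟩
  exact ⟨s.subtype _, Subtype.ext (congrArg finsetBound (Finset.subtype_map_of_mem hs))⟩

end DirectedHull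

lemma exists_directed_chain (I : Type w) [Preorder I] [IsDirectedOrder I] [Infinite I] :
    ∃ A : (#I).ord.cof.ord.ToType →o Set I,
      (∀ t, DirectedOn (· ≤ ·) (A t) ∧ (A t).Nonempty ∧ HasCardinalLT (A t) #I) ∧
        ∀ i, ∃ t, i ∈ A t := by
  obtain ⟨f⟩ : Nonempty ((#I).ord.ToType ≃ I) := Cardinal.eq.1 (by simp)
  obtain ⟨g, hg⟩ := Ordinal.exists_isFundamentalSeq (o := (#I).ord) rfl
  let bound (t : (#I).ord.cof.ord.ToType) : (#I).ord.ToType := .mk (g (Ordinal.ToType.mk.symm t))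
  have monotone_bound : Monotone bound := Ordinal.ToType.mk.monotone.comp
    (hg.strictMono.monotone.comp Ordinal.ToType.mk.symm.monotone)
  have cofinal_bound (x : (#I).ord.ToType) : ∃ t, x ≤ bound t := by
    obtain ⟨_, ⟨t, rfl⟩, ht⟩ := hg.isCofinal_range (Ordinal.ToType.mk.symm x)
    exact ⟨.mk t, by simpa [bound] using Ordinal.ToType.mk.symm_apply_le.1 ht⟩
  refine ⟨⟨fun t ↦ directedHull (f '' Set.Iic (bound t)), fun s t hst ↦
    directedHull_mono (Set.image_mono (Set.Iic_subset_Iic.2 (monotone_bound hst)))⟩, fun t ↦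
      ⟨directedOn_directedHull _, directedHull_nonempty _,
        hasCardinalLT_directedHull (aleph0_le_mk I) ?_⟩, fun i ↦ ?_⟩
  · rw [hasCardinalLT_iff_cardinal_mk_lt]
    refine mk_image_le.trans_lt ?_
    simpa using mk_Iic_lt (bound t) (by simp) (by simp)
  · obtain ⟨x, rfl⟩ := f.surjective i
    obtain ⟨t, ht⟩ := cofinal_bound x
    exact ⟨t, subset_directedHull _ ⟨x, ht, rfl⟩⟩

/-- The poset, ordered by inclusion, of the nonempty directed subsets of `J` of cardinality less
than `κ`. -/
abbrev DirectedSubset (J : Type w) [Preorder J] (κ : Cardinal.{w}) : Type w :=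
  {S : Set J // DirectedOn (· ≤ ·) S ∧ S.Nonempty ∧ HasCardinalLT S κ}

section DirectedSubset

variable {J : Type w} [Preorder J] {κ : Cardinal.{w}}

lemma exists_directedSubset_eq_iUnion [Fact κ.IsRegular] (hκ : ℵ₀ < κ)
    (S : ℕ →o DirectedSubset J κ) : ∃ T : DirectedSubset J κ, T.1 = ⋃ n, (S n).1 := by
  refine ⟨⟨⋃ n, (S n).1, Set.directedOn_iUnion S.monotone.directed_le fun n ↦ (S n).2.1,
    Set.nonempty_iUnion.2 ⟨0, (S 0).2.2.1⟩, hasCardinalLT_iUnion _ ?_ fun n ↦ (S n).2.2.2⟩, rfl⟩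
  simpa [HasCardinalLT] using hκ

variable [IsDirectedOrder J] [Nonempty J]

lemma exists_directedSubset_superset (hκ : ℵ₀ ≤ κ) {S : Set J} (hS : HasCardinalLT S κ) :
    ∃ T : DirectedSubset J κ, S ⊆ T.1 :=
  ⟨⟨directedHull S, directedOn_directedHull S, directedHull_nonempty S,
    hasCardinalLT_directedHull hκ hS⟩, subset_directedHull S⟩

lemma exists_directedSubset_mem (hκ : ℵ₀ ≤ κ) (j : J) : ∃ T : DirectedSubset J κ, j ∈ T.1 := by
  obtain ⟨T, hT⟩ := exists_directedSubset_superset (S := {j}) hκ (hasCardinalLT_of_finite _ _ hκ)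
  exact ⟨T, hT rfl⟩

instance isCardinalFiltered_directedSubset [Fact κ.IsRegular] :
    IsCardinalFiltered (DirectedSubset J κ) κ :=
  isCardinalFiltered_preorder _ _ fun ι S hι ↦ by
    obtain ⟨T, hT⟩ := exists_directedSubset_superset (Fact.out : κ.IsRegular).aleph0_le
      (hasCardinalLT_iUnion (fun i ↦ (S i).1) ((hasCardinalLT_iff_cardinal_mk_lt _ _).2 hι)
        fun i ↦ (S i).2.2.2)
    exact ⟨T, fun i ↦ (Set.subset_iUnion _ i).trans hT⟩

end DirectedSubset

section PartialColimits

variable {C : Type u} [Category.{v} C] {J : Type*} [Preorder J]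

/-- The restriction of a diagram indexed by a preorder to a subset. -/
abbrev restrict (D : J ⥤ C) (S : Set J) : S ⥤ C where
  obj j := D.obj j
  map f := D.map (homOfLE (leOfHom f))
  map_comp _ _ := D.map_comp _ _

/-- The restriction of a cocone to a subset of the indexing preorder. -/
abbrev restrictCocone {D : J ⥤ C} (c : Cocone D) (S : Set J) : Cocone (restrict D S) where
  pt := c.pt
  ι := { app j := c.ι.app j }

section

variable {D : J ⥤ C} {S T : Set J} (h : S ⊆ T)

/-- The restriction to a smaller subset of a cocone over a restricted diagram. -/
abbrev restrictCoconeOfSubset (c : Cocone (restrict D T)) : Cocone (restrict D S) where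
  pt := c.pt
  ι :=
    { app j := c.ι.app (Set.inclusion h j)
      naturality i j f := c.ι.naturality
        (homOfLE (leOfHom f) : Set.inclusion h i ⟶ Set.inclusion h j) }

variable (D) in
/-- The map between the colimits of two restrictions of a diagram induced by an inclusion. -/
noncomputable def colimitRestrictMap [HasColimit (restrict D S)]
  [HasColimit (restrict D T)] : colimit (restrict D S) ⟶ colimit (restrict D T) :=
  colimit.desc (restrict D S) (restrictCoconeOfSubset h (colimit.cocone (restrict D T)))

variable [HasColimit (restrict D S)]
  [HasColimit (restrict D T)]

@[simp]
lemma ι_colimitRestrictMap (j : S) : colimit.ι (restrict D S) j ≫ colimitRestrictMap D h =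
    colimit.ι (restrict D T) (Set.inclusion h j) :=
  colimit.ι_desc _ _

@[simp]
lemma ι_colimitRestrictMap_assoc (j : S) {X : C} (f : colimit (restrict D T) ⟶ X) :
    colimit.ι (restrict D S) j ≫ colimitRestrictMap D h ≫ f =
      colimit.ι (restrict D T) (Set.inclusion h j) ≫ f := by
  rw [← Category.assoc, ι_colimitRestrictMap]

end

variable {K : Type*} [Preorder K] (D : J ⥤ C) (A : K →o Set J)
  [∀ k, HasColimit (restrict D (A k))]

/-- The diagram of the colimits of `D` over the members of an increasing family of subsets. -/
noncomputable abbrev partialColimits : K ⥤ C where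
  obj k := colimit (restrict D (A k))
  map f := colimitRestrictMap D (A.monotone (leOfHom f))
  map_id k := colimit.hom_ext fun j ↦ by simp
  map_comp f g := colimit.hom_ext fun j ↦ by simp

variable {D}

/-- The cocone over the diagram of partial colimits induced by a cocone over `D`. -/
noncomputable abbrev partialColimitsCocone (c : Cocone D) : Cocone (partialColimits D A) where
  pt := c.pt
  ι :=
    { app k := colimit.desc (restrict D (A k)) (restrictCocone c (A k))
      naturality k l f := colimit.hom_ext fun j ↦ by simp }

variable {A}

lemma ι_comp_app_eq_of_le (s : Cocone (partialColimits D A)) {k l : K} (hkl : k ≤ l) {j : J}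
    (hj : j ∈ A k) : colimit.ι (restrict D (A k)) ⟨j, hj⟩ ≫ s.ι.app k =
      colimit.ι (restrict D (A l)) ⟨j, A.monotone hkl hj⟩ ≫ s.ι.app l := by
  simp [← s.w (homOfLE hkl)]

section

variable [IsDirectedOrder K]

lemma ι_comp_app_eq (s : Cocone (partialColimits D A)) {k l : K} {j : J} (hk : j ∈ A k)
    (hl : j ∈ A l) : colimit.ι (restrict D (A k)) ⟨j, hk⟩ ≫ s.ι.app k =
      colimit.ι (restrict D (A l)) ⟨j, hl⟩ ≫ s.ι.app l := by
  obtain ⟨m, hkm, hlm⟩ := exists_ge_ge k l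
  rw [ι_comp_app_eq_of_le s hkm, ι_comp_app_eq_of_le s hlm]

variable {σ : J → K} (hσ : ∀ j, j ∈ A (σ j))

/-- The cocone over `D` induced by a cocone over the diagram of partial colimits, where `σ` selects
for each index a member of the family containing it. -/
noncomputable abbrev coconeOfPartialColimits (s : Cocone (partialColimits D A)) : Cocone D where
  pt := s.pt
  ι :=
    { app j := colimit.ι (restrict D (A (σ j))) ⟨j, hσ j⟩ ≫ s.ι.app (σ j)
      naturality i j f := by
        obtain ⟨l, hi, hj⟩ := exists_ge_ge (σ i) (σ j)
        have := colimit.w (restrict D (A l))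
          (homOfLE (leOfHom f) : (⟨i, A.monotone hi (hσ i)⟩ : A l) ⟶ ⟨j, A.monotone hj (hσ j)⟩)
        rw [ι_comp_app_eq_of_le s hi, ι_comp_app_eq_of_le s hj, ← this]
        simp [Subsingleton.elim (homOfLE (leOfHom f)) f] }

/-- A colimit is the colimit of its partial colimits over a directed family of subsets
covering the index set. -/
noncomputable def isColimitPartialColimitsCocone {c : Cocone D} (hc : IsColimit c) :
    IsColimit (partialColimitsCocone A c) where
  desc s := hc.desc (coconeOfPartialColimits hσ s)
  fac s k := colimit.hom_ext fun j ↦ by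
    rw [colimit.ι_desc_assoc, hc.fac]
    exact ι_comp_app_eq s _ j.2
  uniq s m hm := hc.hom_ext fun j ↦ by simp [← hm]

end

/-- A colimit of partial colimits is the colimit over the union of the family. -/
noncomputable def isColimitRestrictCoconeIUnion {c : Cocone D}
    (hc : IsColimit (partialColimitsCocone A c)) :
    IsColimit (restrictCocone c (⋃ k, A k)) where
  desc s := hc.desc
    { pt := s.pt
      ι :=
        { app k := colimit.desc (restrict D (A k))
            (restrictCoconeOfSubset (Set.subset_iUnion A k) s)
          naturality k l f := colimit.hom_ext fun j ↦ by simp } }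
  fac s := by
    rintro ⟨j, hj⟩
    obtain ⟨k, hk⟩ := Set.mem_iUnion.1 hj
    have : c.ι.app j = colimit.ι (restrict D (A k)) ⟨j, hk⟩ ≫ (partialColimitsCocone A c).ι.app k :=
      (colimit.ι_desc (restrictCocone c (A k)) ⟨j, hk⟩).symm
    rw [this, Category.assoc, hc.fac]
    simp
  uniq s m hm := hc.hom_ext fun k ↦ by
    rw [hc.fac]
    exact colimit.hom_ext fun j ↦ by simp [← hm]

end PartialColimits

section Presentability

variable {C : Type u} [Category.{v} C]

lemma exists_section_interleaving {κ : Cardinal.{w}} [Fact κ.IsRegular] {K : Type*} [Category* K]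
    [EssentiallySmall.{w} K] [IsCardinalFiltered K κ] {F : K ⥤ C} {c : Cocone F} (hc : IsColimit c)
    [IsCardinalPresentable c.pt κ] [∀ k, IsCardinalPresentable (F.obj k) κ] :
    ∃ (k₀ : K) (s : c.pt ⟶ F.obj k₀), s ≫ c.ι.app k₀ = 𝟙 c.pt ∧
      ∀ a : Under k₀, ∃ (b : Under k₀) (g : a ⟶ b),
        c.ι.app a.right ≫ s ≫ F.map b.hom = F.map g.right := by
  obtain ⟨k₀, s, hs⟩ := IsCardinalPresentable.exists_hom_of_isColimit κ hc (𝟙 c.pt)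
  refine ⟨k₀, s, hs, fun a ↦ ?_⟩
  have agree_in_colimit : (c.ι.app a.right ≫ s ≫ F.map a.hom) ≫ c.ι.app a.right =
      𝟙 _ ≫ c.ι.app a.right := by
    simp [hs]
  obtain ⟨k, u, hu⟩ := IsCardinalPresentable.exists_eq_of_isColimit' κ hc _ _ agree_in_colimit
  exact ⟨.mk (a.hom ≫ u), Under.homMk u, by simpa using hu⟩

/-- A cocone over a sequence is a colimit if its apex is a retract of the first term such that every
composite through the apex is a transition map. -/
def isColimitOfNatSection {E : ℕ ⥤ C} {c : Cocone E} (s : c.pt ⟶ E.obj 0)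
    (hs : s ≫ c.ι.app 0 = 𝟙 c.pt)
    (h : ∀ n, c.ι.app n ≫ s ≫ E.map (homOfLE (n + 1).zero_le) = E.map (homOfLE n.le_succ)) :
    IsColimit c where
  desc t := s ≫ t.ι.app 0
  fac t n := by
    rw [← t.w (homOfLE (n + 1).zero_le), ← t.w (homOfLE n.le_succ), ← h n]
    simp only [Category.assoc]
  uniq t m hm := by
    rw [← hm 0]
    simpa using (hs =≫ m).symm

lemma exists_nat_functor_isColimit_whisker {κ : Cardinal.{w}} [Fact κ.IsRegular] {K : Type*}
    [Category* K] [EssentiallySmall.{w} K] [IsCardinalFiltered K κ] {F : K ⥤ C} {c : Cocone F}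
    (hc : IsColimit c) [IsCardinalPresentable c.pt κ] [∀ k, IsCardinalPresentable (F.obj k) κ] :
    ∃ G : ℕ ⥤ K, Nonempty (IsColimit (c.whisker G)) := by
  obtain ⟨k₀, s, hs, h⟩ := exists_section_interleaving (κ := κ) hc
  choose next g hg using h
  let a : ℕ → Under k₀ := Nat.rec (.mk (𝟙 k₀)) fun _ ↦ next
  let G : ℕ ⥤ Under k₀ := Functor.ofSequence (X := a) fun n ↦ g (a n)
  have map_zero_right (n : ℕ) : (G.map (homOfLE n.zero_le)).right = (a n).hom :=
    (Category.id_comp _).symm.trans (Under.w (G.map (homOfLE n.zero_le)))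
  have map_succ (n : ℕ) : G.map (homOfLE n.le_succ) = g (a n) :=
    Functor.ofSequence_map_homOfLE_succ ..
  refine ⟨G ⋙ Under.forget k₀, ⟨isColimitOfNatSection s hs fun n ↦ ?_⟩⟩
  exact (congrArg (fun f ↦ c.ι.app (a n).right ≫ s ≫ F.map f) (map_zero_right (n + 1))).trans
    ((hg (a n)).trans (congrArg (fun f ↦ F.map f.right) (map_succ n).symm))

lemma hasCardinalLT_arrow_preorder {J : Type*} [Preorder J] {κ : Cardinal.{w}} (hκ : ℵ₀ ≤ κ)
    (hJ : HasCardinalLT J κ) : HasCardinalLT (Arrow J) κ :=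
  (hasCardinalLT_prod hκ hJ hJ).of_injective (fun f : Arrow J ↦ (f.left, f.right)) (by
    rintro ⟨a, b, f⟩ ⟨a', b', f'⟩ h
    obtain ⟨rfl, rfl⟩ := Prod.ext_iff.1 h
    obtain rfl : f = f' := Subsingleton.elim _ _
    rfl)

lemma IsPresentableAt.mono {X : C} {θ κ : Cardinal.{w}} (h : IsPresentableAt X θ)
    (hκ : κ.IsRegular) (hle : θ ≤ κ) : IsPresentableAt X κ := by
  obtain ⟨_, _⟩ := h
  have : Fact κ.IsRegular := ⟨hκ⟩
  exact ⟨inferInstance, isCardinalPresentable_of_le X hle⟩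

lemma isPresentableAt_of_isColimit [LocallySmall.{w} C] {J : Type w} [Preorder J] {D : J ⥤ C}
    {c : Cocone D} (hc : IsColimit c) {κ : Cardinal.{w}} (hκ : κ.IsRegular)
    (hJ : HasCardinalLT J κ) (hD : ∀ j, IsPresentableAt (D.obj j) κ) :
    IsPresentableAt c.pt κ := by
  have : Fact κ.IsRegular := ⟨hκ⟩
  have (j : J) : IsCardinalPresentable (D.obj j) κ := (hD j).2
  exact ⟨inferInstance, isCardinalPresentable_of_isColimit c hc κ
    (hasCardinalLT_arrow_preorder hκ.aleph0_le hJ)⟩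

lemma HasDirectedColimits.hasColimit_restrict (hC : HasDirectedColimits.{w} C) {J : Type w}
    [PartialOrder J] (D : J ⥤ C) {S : Set J} (hS : DirectedOn (· ≤ ·) S) (hS' : S.Nonempty) :
    HasColimit (restrict D S) := by
  have := hS.isDirectedOrder
  have := hS'.to_subtype
  have := hC S
  infer_instance

lemma exists_isColimit_restrictCocone [LocallySmall.{w} C] (hC : HasDirectedColimits.{w} C)
    {J : Type w} [PartialOrder J] [IsDirectedOrder J] [Nonempty J] {D : J ⥤ C} {c : Cocone D}
    (hc : IsColimit c) {κ : Cardinal.{w}} (hκ : ℵ₀ < κ) (hX : IsPresentableAt c.pt κ)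
    (hD : ∀ j, IsPresentableAt (D.obj j) κ) :
    ∃ T : DirectedSubset J κ, Nonempty (IsColimit (restrictCocone c T.1)) := by
  obtain ⟨_, _⟩ := hX
  have := isFiltered_of_isCardinalFiltered (DirectedSubset J κ) κ
  have := IsFiltered.isDirectedOrder (DirectedSubset J κ)
  let A : DirectedSubset J κ →o Set J := ⟨Subtype.val, fun _ _ h ↦ h⟩
  have hasColimit (T : DirectedSubset J κ) : HasColimit (restrict D (A T)) :=
    hC.hasColimit_restrict D T.2.1 T.2.2.1
  have (T : DirectedSubset J κ) : IsCardinalPresentable ((partialColimits D A).obj T) κ :=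
    (isPresentableAt_of_isColimit (colimit.isColimit _) Fact.out T.2.2.2 fun j ↦ hD j).2
  choose σ hσ using exists_directedSubset_mem (J := J) hκ.le
  obtain ⟨G, ⟨hG⟩⟩ := exists_nat_functor_isColimit_whisker (κ := κ)
    (isColimitPartialColimitsCocone (A := A) hσ hc)
  let S : ℕ →o DirectedSubset J κ := ⟨G.obj, G.monotone⟩
  have (n : ℕ) : HasColimit (restrict D (A.comp S n)) := hasColimit (S n)
  obtain ⟨T, hT⟩ := exists_directedSubset_eq_iUnion hκ S
  have isColimit_iUnion : IsColimit (restrictCocone c (⋃ n, (S n).1)) :=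
    isColimitRestrictCoconeIUnion (A := A.comp S) hG
  exact ⟨T, hT ▸ ⟨isColimit_iUnion⟩⟩

lemma isLTPresentable_of_isColimit [LocallySmall.{w} C] {J : Type w} [Preorder J] {D : J ⥤ C}
    {c : Cocone D} (hc : IsColimit c) {lam κ : Cardinal.{w}} (hlam : lam.IsRegular) (hlt : lam < κ)
    (hJ : Order.succ #J < κ) (hD : ∀ j, IsPresentableAt (D.obj j) lam) :
    IsLTPresentable c.pt κ := by
  obtain ⟨θ, hθ, hlamθ, hθκ, hJθ⟩ : ∃ θ : Cardinal.{w}, θ.IsRegular ∧ lam ≤ θ ∧ θ < κ ∧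
      HasCardinalLT J θ := by
    simp only [hasCardinalLT_iff_cardinal_mk_lt]
    obtain h | h := lt_or_ge #J lam
    · exact ⟨lam, hlam, le_rfl, hlt, h⟩
    · exact ⟨Order.succ #J, isRegular_succ (hlam.aleph0_le.trans h), h.trans (Order.le_succ _), hJ,
        Order.lt_succ _⟩
  exact ⟨θ, hθκ.trans_le (self_le_add_right _ _),
    isPresentableAt_of_isColimit hc hθ hJθ fun j ↦ (hD j).mono hθ hlamθ⟩

lemma isFiltrable_of_isColimit [LocallySmall.{w} C] (hC : HasDirectedColimits.{w} C)
    {J : Type w} [PartialOrder J] [IsDirectedOrder J] {D : J ⥤ C} {c : Cocone D}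
    (hc : IsColimit c) {lam κ : Cardinal.{w}} (hlam : lam.IsRegular) (hlt : lam < κ)
    (hJ : HasCardinalLT J κ) (hD : ∀ j, IsPresentableAt (D.obj j) lam)
    (hκ : HasPresentabilityRank c.pt κ) : IsFiltrable.{w} c.pt := by
  rw [hasCardinalLT_iff_cardinal_mk_lt] at hJ
  have le_mk : lam ≤ #J := by
    by_contra! mk_lt
    exact hlt.not_ge (hκ.2 (isPresentableAt_of_isColimit hc hlam
      ((hasCardinalLT_iff_cardinal_mk_lt _ _).2 mk_lt) hD))
  have : Infinite J := infinite_iff.2 (hlam.aleph0_le.trans le_mk)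
  obtain ⟨A, hA, mem_A⟩ := exists_directed_chain J
  choose σ hσ using mem_A
  have (t : (#J).ord.cof.ord.ToType) : HasColimit (restrict D (A t)) :=
    hC.hasColimit_restrict D (hA t).1 (hA t).2.1
  refine ⟨κ, hκ, (#J).ord.cof, isRegular_cof (isSuccLimit_ord (aleph0_le_mk J)),
    (Ordinal.cof_ord_le _).trans_lt hJ, ⟨_, _, isColimitPartialColimitsCocone hσ hc⟩, fun t ↦ ?_⟩
  have mk_lt : #(A t) < #J := (hasCardinalLT_iff_cardinal_mk_lt _ _).1 (hA t).2.2
  exact isLTPresentable_of_isColimit (colimit.isColimit _) hlam hlt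
    ((Order.succ_le_of_lt mk_lt).trans_lt hJ) fun _ ↦ hD _

end Presentability

section Accessible

variable {C : Type u} [Category.{v} C]

/-- `X` is a colimit of `κ`-presentable objects indexed by a nonempty small directed poset, as is
every object of a `κ`-accessible category. -/
def IsDirectedColimitOfPresentables (X : C) (κ : Cardinal.{w}) : Prop :=
  ∃ (J : Type w) (_ : PartialOrder J) (_ : IsDirectedOrder J) (_ : Nonempty J)
    (P : ColimitPresentation J X), ∀ j, IsPresentableAt (P.diag.obj j) κ

lemma isDirectedColimitOfPresentables (κ : Cardinal.{w}) [Fact κ.IsRegular]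
    [IsCardinalAccessibleCategory C κ] (X : C) : IsDirectedColimitOfPresentables X κ := by
  obtain ⟨J, _, _, ⟨P⟩⟩ :=
    (isCardinalFilteredGenerator_isCardinalPresentable C κ).exists_colimitsOfShape X
  obtain ⟨α, _, _, F, _⟩ := IsCardinalFiltered.exists_cardinal_directed J κ
  have := isFiltered_of_isCardinalFiltered α κ
  exact ⟨α, inferInstance, IsFiltered.isDirectedOrder α, IsFiltered.nonempty,
    P.toColimitPresentation.reindex F, fun j ↦ ⟨inferInstance, P.prop_diag_obj (F.obj j)⟩⟩

variable (C) in
lemma hasDirectedColimits_of_isFinitelyAccessible [IsFinitelyAccessibleCategory.{w} C] :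
    HasDirectedColimits.{w} C := by
  intro J _ _ _
  have := fact_isRegular_aleph0.{w}
  have : IsCardinalFiltered J (ℵ₀ : Cardinal.{w}) :=
    (isCardinalFiltered_aleph0_iff J).2 inferInstance
  exact HasCardinalFilteredColimits.hasColimitsOfShape C (ℵ₀ : Cardinal.{w}) J

lemma IsWellFiltrableCategory.isAlmostWellFiltrableCategory {μ : Cardinal.{w}}
    (h : IsWellFiltrableCategory C μ) : IsAlmostWellFiltrableCategory C μ :=
  fun κ hκ hμκ X hX ↦ ⟨X, h κ hκ hμκ X hX, hX.1, 𝟙 X, inferInstance⟩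

end Accessible

end Filtrations

theorem mainTheorem8_general (C : Type u) [Category.{v} C] [LocallySmall.{w} C]
    (hC : Filtrations.HasDirectedColimits.{w} C) (lam : Cardinal.{w})
    (h : ∀ X : C, Filtrations.IsDirectedColimitOfPresentables X lam) :
    Filtrations.IsWellFiltrableCategory C (Order.succ lam) := by
  intro κ _ hle X hX
  have lam_lt : lam < κ := Order.succ_le_iff.1 hle
  obtain ⟨J, _, _, _, P, hP⟩ := h X
  have hlam : lam.IsRegular := (hP (Classical.arbitrary J)).1.out
  obtain ⟨⟨T, hT, _, hTκ⟩, ⟨isColimit_T⟩⟩ := Filtrations.exists_isColimit_restrictCocone hC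
    P.isColimit (hlam.aleph0_le.trans_lt lam_lt) hX.1 fun j ↦ (hP j).mono hX.1.1.out lam_lt.le
  have := hT.isDirectedOrder
  exact Filtrations.isFiltrable_of_isColimit hC isColimit_T hlam lam_lt hTκ (fun _ ↦ hP _) hX

theorem mainTheorem8 (C : Type u) [Category.{v} C] :
    (IsFinitelyAccessibleCategory.{w} C →
      Filtrations.IsWellFiltrableCategory.{w} C ℵ₁) ∧
    (∀ (lam : Cardinal.{w}) [Fact lam.IsRegular], IsCardinalAccessibleCategory C lam →
      Filtrations.HasDirectedColimits.{w} C →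
        Filtrations.IsAlmostWellFiltrableCategory C (Order.succ lam)) ∧
    (∀ (lam : Cardinal.{w}) [Fact lam.IsRegular], IsCardinalAccessibleCategory C lam →
      Filtrations.HasDirectedColimits.{w} C →
        (∀ (X Y : C) (f : X ⟶ Y), Mono f) →
          Filtrations.IsWellFiltrableCategory C (Order.succ lam)) := by
  have well (lam : Cardinal.{w}) [Fact lam.IsRegular] [IsCardinalAccessibleCategory C lam]
      (hC : Filtrations.HasDirectedColimits.{w} C) :=
    mainTheorem8_general C hC lam (Filtrations.isDirectedColimitOfPresentables lam)
  have := fact_isRegular_aleph0.{w}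
  exact ⟨fun _ ↦ succ_aleph0 ▸ well ℵ₀ (Filtrations.hasDirectedColimits_of_isFinitelyAccessible C),
    fun lam _ _ hC ↦ (well lam hC).isAlmostWellFiltrableCategory, fun lam _ _ hC _ ↦ well lam hC⟩
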